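/- All vector spaces are real and all operators are linear and norm bounded. For a Banach lattice $E$ let $E^*$ be its norm dual with the order $f\le g \iff f(x)\le g(x)$ for all $x\ge 0$. A Banach lattice is a KB-space if every norm bounded increasing sequence of positive elements converges in norm. An operator $T:E\to F$ between Banach lattices is called order M-weakly compact (oMwc) if $f_n(Tx_n)\to 0$ for every order bounded sequence $(f_n)$ in $F^*$ and every norm bounded disjoint sequence $(x_n)$ in $E$ (disjoint: $|x_m|\wedge|x_n|=0$ for $m\ne n$). It is called order bounded if it maps order bounded sets to order bounded sets, and regular if it is a difference of two positive operators. Proposition. For a Banach lattice $E$ the following conditions are equivalent. (i) $E^*$ is a KB-space. (ii) For every Banach lattice $F$, every order bounded operator $T:E\to F$ is oMwc. (iii) For every Banach lattice $F$, every regular operator $T:E\to F$ is oMwc. (iv) For every Banach lattice $F$, every compact operator $T:E\to F$ is oMwc. (v) Every bounded operator $T:E\to E$ of rank one is oMwc. -/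

import Mathlib

/-!
A (real) Banach lattice is a type `E` with the instances
`[NormedAddCommGroup E] [NormedSpace ℝ E] [CompleteSpace E] [Lattice E] [IsOrderedAddMonoid E]
[IsOrderedModule ℝ E] [HasSolidNorm E]`. Operators are bounded linear maps `E →L[ℝ] F`.
-/

namespace BanachLattice

/-- The canonical order on the norm dual of a normed lattice:
`f ≤ g` iff `f x ≤ g x` for every `x ≥ 0`. -/
instance dualPartialOrder {E : Type*} [NormedAddCommGroup E] [NormedSpace ℝ E] [Lattice E]
    [IsOrderedAddMonoid E] : PartialOrder (StrongDual ℝ E) where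
  le f g := ∀ x : E, 0 ≤ x → f x ≤ g x
  le_refl _ _ _ := le_rfl
  le_trans _ _ _ h₁ h₂ x hx := (h₁ x hx).trans (h₂ x hx)
  le_antisymm f g h₁ h₂ := by
    ext x
    have hp : f x⁺ = g x⁺ := le_antisymm (h₁ _ (posPart_nonneg x)) (h₂ _ (posPart_nonneg x))
    have hn : f x⁻ = g x⁻ := le_antisymm (h₁ _ (negPart_nonneg x)) (h₂ _ (negPart_nonneg x))
    rw [← posPart_sub_negPart x, map_sub, map_sub, hp, hn]

/-- The KB-property: every norm bounded increasing sequence of positive elements is norm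
convergent. Only the norm and the order of the Banach lattice `X` enter. -/
def IsKBSpace (X : Type*) [NormedAddCommGroup X] [PartialOrder X] : Prop :=
  ∀ x : ℕ → X, Monotone x → (∀ n, 0 ≤ x n) → (∃ C : ℝ, ∀ n, ‖x n‖ ≤ C) →
    ∃ a : X, Filter.Tendsto x Filter.atTop (nhds a)

/-- A set is order bounded if it is contained in an order interval `[a, b]`. -/
def OrderBounded {X : Type*} [PartialOrder X] (s : Set X) : Prop :=
  ∃ a b : X, s ⊆ Set.Icc a b

/-- A sequence is disjoint if its terms are pairwise disjoint: `|x m| ⊓ |x n| = 0` for `m ≠ n`. -/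
def DisjointSeq {E : Type*} [AddCommGroup E] [Lattice E] (x : ℕ → E) : Prop :=
  ∀ m n : ℕ, m ≠ n → |x m| ⊓ |x n| = 0

section Operators

variable {E F : Type*}
  [NormedAddCommGroup E] [NormedSpace ℝ E] [Lattice E] [IsOrderedAddMonoid E]
  [NormedAddCommGroup F] [NormedSpace ℝ F] [Lattice F] [IsOrderedAddMonoid F]

/-- Order M-weakly compact operators: `f n (T (x n)) → 0` for every order bounded sequence `f`
in `F*` and every disjoint norm bounded sequence `x` in `E`. -/
def IsOrderMWeaklyCompact (T : E →L[ℝ] F) : Prop :=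
  ∀ (f : ℕ → StrongDual ℝ F) (x : ℕ → E), OrderBounded (Set.range f) → DisjointSeq x →
    (∃ C : ℝ, ∀ n, ‖x n‖ ≤ C) →
    Filter.Tendsto (fun n => f n (T (x n))) Filter.atTop (nhds 0)

/-- Order bounded operators map order bounded sets to order bounded sets. -/
def IsOrderBoundedOp (T : E →L[ℝ] F) : Prop :=
  ∀ s : Set E, OrderBounded s → OrderBounded (T '' s)

/-- Positive operators. -/
def IsPositiveOp (T : E →L[ℝ] F) : Prop :=
  ∀ x : E, 0 ≤ x → 0 ≤ T x

/-- Regular operators are the differences of two positive operators. -/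
def IsRegularOp (T : E →L[ℝ] F) : Prop :=
  ∃ R S : E →L[ℝ] F, IsPositiveOp R ∧ IsPositiveOp S ∧ T = R - S

/-- Operators with one-dimensional range. -/
def IsRankOne (T : E →L[ℝ] F) : Prop :=
  Module.finrank ℝ (LinearMap.range (T : E →ₗ[ℝ] F)) = 1

end Operators

end BanachLattice

universe u v

namespace BanachLattice

open Filter Topology

section LatticeGroup

variable {E : Type*} [AddCommGroup E] [Lattice E] [IsOrderedAddMonoid E]

theorem inf_add_le_add_inf {x y u : E} (hx : 0 ≤ x) (hy : 0 ≤ y) (hu : 0 ≤ u) :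
    u ⊓ (x + y) ≤ u ⊓ x + u ⊓ y := by
  rw [add_inf, inf_add, inf_add]
  refine le_inf (le_inf ?_ ?_) (le_inf ?_ inf_le_right)
  · exact inf_le_left.trans (le_add_of_nonneg_left hu)
  · exact inf_le_left.trans (le_add_of_nonneg_left hx)
  · exact inf_le_left.trans (le_add_of_nonneg_right hy)

theorem inf_add_eq_zero {x y u : E} (hx : 0 ≤ x) (hy : 0 ≤ y) (hu : 0 ≤ u)
    (hux : u ⊓ x = 0) (huy : u ⊓ y = 0) : u ⊓ (x + y) = 0 := by
  refine le_antisymm ?_ (le_inf hu (add_nonneg hx hy))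
  simpa [hux, huy] using inf_add_le_add_inf hx hy hu

theorem inf_nsmul_eq_zero {x u : E} (hx : 0 ≤ x) (hu : 0 ≤ u) (hux : u ⊓ x = 0) (k : ℕ) :
    u ⊓ k • x = 0 := by
  induction k with
  | zero => simpa using hu
  | succ k ih => rw [succ_nsmul]; exact inf_add_eq_zero (nsmul_nonneg hx k) hx hu ih hux

theorem nsmul_inf_nsmul_eq_zero {x u : E} (hx : 0 ≤ x) (hu : 0 ≤ u) (hux : u ⊓ x = 0) (k : ℕ) :
    k • u ⊓ k • x = 0 := by
  have h := inf_nsmul_eq_zero hx hu hux k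
  rw [inf_comm] at h ⊢
  exact inf_nsmul_eq_zero hu (nsmul_nonneg hx k) h k

theorem inf_eq_zero_of_le {E : Type*} [Lattice E] [Zero E] {x y u v : E} (hx : 0 ≤ x) (hy : 0 ≤ y) (hxu : x ≤ u) (hyv : y ≤ v)
    (h : u ⊓ v = 0) : x ⊓ y = 0 :=
  le_antisymm ((inf_le_inf hxu hyv).trans h.le) (le_inf hx hy)

/-- A finite sum of pairwise disjoint positive elements below `x` is below `x`. -/
theorem sum_range_le_of_disjoint {x : E} (hx : 0 ≤ x) {y : ℕ → E} (hy : ∀ i, 0 ≤ y i)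
    (hyx : ∀ i, y i ≤ x) (hd : ∀ i j, i ≠ j → y i ⊓ y j = 0) (n : ℕ) :
    ∑ i ∈ Finset.range n, y i ≤ x := by
  have key : ∀ n, ∑ i ∈ Finset.range n, y i ≤ x ∧
      ∀ m, n ≤ m → y m ⊓ ∑ i ∈ Finset.range n, y i = 0 := by
    intro n
    induction n with
    | zero => simpa using ⟨hx, fun m => hy m⟩
    | succ n ih =>
      have hs : 0 ≤ ∑ i ∈ Finset.range n, y i := Finset.sum_nonneg fun i _ => hy i
      rw [Finset.sum_range_succ]
      refine ⟨?_, fun m hm => inf_add_eq_zero hs (hy n) (hy m) (ih.2 m (by lia))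
        (hd m n (by lia))⟩
      rw [← inf_add_sup, inf_comm, ih.2 n le_rfl, zero_add]
      exact sup_le ih.1 (hyx n)
  exact (key n).1

theorem inf_nsmul_add_le (x y u : E) (k l : ℕ) :
    x ⊓ k • u + y ⊓ l • u ≤ (x + y) ⊓ (k + l) • u := by
  refine le_inf (add_le_add inf_le_left inf_le_left) ?_
  rw [add_nsmul]
  exact add_le_add inf_le_right inf_le_right

theorem add_inf_le {x y u : E} (hx : 0 ≤ x) (hy : 0 ≤ y) (hu : 0 ≤ u) :
    (x + y) ⊓ u ≤ x ⊓ u + y ⊓ u := by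
  simpa only [inf_comm] using inf_add_le_add_inf hx hy hu

theorem sub_inf_le {x y z : E} (hy : 0 ≤ y) (hz : z ≤ x + y) : z - z ⊓ x ≤ y := by
  rw [sub_le_iff_le_add', inf_add]
  exact le_inf (le_add_of_nonneg_right hy) hz

/-- If `p` is subadditive, each partition of `x + y` is refined by partitions of `x` and `y`. -/
theorem exists_partition_add {p : E → ℝ} (hp : ∀ x y, p (x + y) ≤ p x + p y) (l : List E) :
    ∀ x y : E, 0 ≤ x → 0 ≤ y → (∀ z ∈ l, 0 ≤ z) → l.sum = x + y →
    ∃ l₁ l₂ : List E, (∀ z ∈ l₁, 0 ≤ z) ∧ l₁.sum = x ∧ (∀ z ∈ l₂, 0 ≤ z) ∧ l₂.sum = y ∧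
      (l.map p).sum ≤ (l₁.map p).sum + (l₂.map p).sum := by
  induction l with
  | nil =>
    intro x y hx hy _ h
    have h : 0 = x + y := by simpa using h
    have hx0 : x = 0 := le_antisymm (h ▸ le_add_of_nonneg_right hy) hx
    have hy0 : y = 0 := le_antisymm (h ▸ le_add_of_nonneg_left hx) hy
    exact ⟨[], [], by simp [hx0, hy0]⟩
  | cons z l ih =>
    intro x y hx hy hl h
    rw [List.sum_cons] at h
    have hz : 0 ≤ z := hl z (by simp)
    have hl' : ∀ w ∈ l, 0 ≤ w := fun w hw => hl w (by simp [hw])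
    have hzxy : z ≤ x + y := h ▸ le_add_of_nonneg_right (List.sum_nonneg hl')
    obtain ⟨l₁, l₂, h₁, s₁, h₂, s₂, hs⟩ := ih (x - z ⊓ x) (y - (z - z ⊓ x))
      (sub_nonneg.2 inf_le_right) (sub_nonneg.2 (sub_inf_le hy hzxy)) hl'
      (by rw [eq_sub_of_add_eq' h]; abel)
    refine ⟨(z ⊓ x) :: l₁, (z - z ⊓ x) :: l₂, ?_, by simp [s₁], ?_, by simp [s₂], ?_⟩
    · simpa using ⟨⟨hz, hx⟩, h₁⟩
    · simpa using h₂
    · have := hp (z ⊓ x) (z - z ⊓ x)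
      rw [add_sub_cancel] at this
      simp only [List.map_cons, List.sum_cons]
      linarith

theorem disjointSeq_abs {x : ℕ → E} (hx : DisjointSeq x) : DisjointSeq fun n => |x n| :=
  fun m n h => by simpa only [abs_abs] using hx m n h

/-- The sum of the terms of a list up to sign lies between `±` the sum of the list. -/
theorem list_sum_abs_bounds {F : Type*} [AddCommGroup F] [Lattice F] [IsOrderedAddMonoid F]
    (T : E →+ F) {x : E} {w : F} (hw : ∀ y, |y| ≤ x → T y ≤ w) (l : List E)
    (hl : ∀ z ∈ l, 0 ≤ z) (hs : l.sum = x) : (l.map fun z => |T z|).sum ≤ w := by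
  have key : ∀ (l : List E) (x : E) (a : F), (∀ z ∈ l, 0 ≤ z) → l.sum = x →
      (∀ y, |y| ≤ x → a + T y ≤ w) → a + (l.map fun z => |T z|).sum ≤ w := by
    intro l
    induction l with
    | nil =>
      intro x a _ h hy
      have h : 0 = x := by simpa using h
      simpa using hy 0 (by simp [← h])
    | cons z l ih =>
      intro x a hl h hy
      rw [List.sum_cons] at h
      have hz : 0 ≤ z := hl z (by simp)
      simp only [List.map_cons, List.sum_cons, ← add_assoc]
      rw [abs, add_sup, sup_add]
      refine sup_le ?_ ?_
      · refine ih l.sum _ (fun w hw => hl w (by simp [hw])) rfl fun y hyl => ?_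
        rw [add_assoc, ← map_add]
        refine hy _ ((abs_add_le _ _).trans ?_)
        rw [abs_of_nonneg hz, ← h]
        gcongr
      · refine ih l.sum _ (fun w hw => hl w (by simp [hw])) rfl fun y hyl => ?_
        rw [add_assoc, ← map_neg, ← map_add]
        refine hy _ ((abs_add_le _ _).trans ?_)
        rw [abs_neg, abs_of_nonneg hz, ← h]
        gcongr
  simpa using key l x 0 hl hs (by simpa using hw)

end LatticeGroup

section Functionals

section

variable {E : Type*} [NormedAddCommGroup E] [NormedSpace ℝ E] [Lattice E] [IsOrderedAddMonoid E]

theorem dual_mono {f : StrongDual ℝ E} (hf : 0 ≤ f) {x y : E} (h : x ≤ y) : f x ≤ f y := by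
  have := hf (y - x) (sub_nonneg.2 h)
  simpa using this

theorem dual_nonneg {f : StrongDual ℝ E} (hf : 0 ≤ f) {x : E} (h : 0 ≤ x) : 0 ≤ f x := by
  simpa using dual_mono hf h

theorem abs_apply_le {f g : StrongDual ℝ E} (hf : 0 ≤ f) (hfg : f ≤ g) (x : E) :
    |f x| ≤ g |x| := by
  refine le_trans ?_ (hfg |x| (abs_nonneg x))
  rw [abs_le, ← map_neg]
  exact ⟨dual_mono hf (neg_le.1 (neg_le_abs x)), dual_mono hf (le_abs_self x)⟩

theorem norm_le_norm_of_dual_le [HasSolidNorm E] {f g : StrongDual ℝ E} (hf : 0 ≤ f)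
    (hfg : f ≤ g) : ‖f‖ ≤ ‖g‖ := by
  refine f.opNorm_le_bound (norm_nonneg g) fun x => (abs_apply_le hf hfg x).trans ?_
  rw [← norm_abs_eq_norm x]
  exact (le_abs_self _).trans (g.le_opNorm |x|)

theorem dual_sub_nonneg {f g : StrongDual ℝ E} (h : f ≤ g) : 0 ≤ g - f :=
  fun x hx => by simpa using h x hx

end

variable {E : Type*} [NormedAddCommGroup E] [NormedSpace ℝ E] [CompleteSpace E] [Lattice E]
  [IsOrderedAddMonoid E] [HasSolidNorm E]

/-- A nonnegative additive function on the positive cone of a Banach lattice extends to a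
positive functional, which is automatically continuous. -/
theorem exists_dual_of_additive (φ : E → ℝ) (h0 : ∀ x, 0 ≤ x → 0 ≤ φ x)
    (hadd : ∀ x y, 0 ≤ x → 0 ≤ y → φ (x + y) = φ x + φ y) :
    ∃ f : StrongDual ℝ E, 0 ≤ f ∧ ∀ x, 0 ≤ x → f x = φ x := by
  have hsub : ∀ x a b : E, 0 ≤ a → 0 ≤ b → x = a - b → φ x⁺ - φ x⁻ = φ a - φ b := by
    intro x a b ha hb h
    have h1 : x⁺ + b = a + x⁻ := by
      rw [← sub_eq_sub_iff_add_eq_add, posPart_sub_negPart, h]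
    have h2 := congrArg φ h1
    rw [hadd _ _ (posPart_nonneg x) hb, hadd _ _ ha (negPart_nonneg x)] at h2
    linarith
  let A : E →+ ℝ := AddMonoidHom.mk' (fun x => φ x⁺ - φ x⁻) fun x y => by
    rw [hsub (x + y) (x⁺ + y⁺) (x⁻ + y⁻) (add_nonneg (posPart_nonneg x) (posPart_nonneg y))
      (add_nonneg (negPart_nonneg x) (negPart_nonneg y))
      (by rw [add_sub_add_comm, posPart_sub_negPart, posPart_sub_negPart]),
      hadd _ _ (posPart_nonneg x) (posPart_nonneg y),
      hadd _ _ (negPart_nonneg x) (negPart_nonneg y)]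
    ring
  have hφ0 : φ 0 = 0 := by simpa using hadd 0 0 le_rfl le_rfl
  have hA : ∀ x, 0 ≤ x → A x = φ x := fun x hx => by
    have h1 := hsub x x 0 hx le_rfl (by simp)
    rw [hφ0, sub_zero] at h1
    exact h1
  have hmono : ∀ x y, 0 ≤ x → x ≤ y → φ x ≤ φ y := fun x y hx hxy => by
    have h1 := hadd x (y - x) hx (sub_nonneg.2 hxy)
    rw [add_sub_cancel] at h1
    linarith [h0 _ (sub_nonneg.2 hxy)]
  have habs : ∀ x, |A x| ≤ φ |x| := fun x => by
    have h1 := hadd _ _ (posPart_nonneg x) (negPart_nonneg x)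
    rw [posPart_add_negPart] at h1
    rw [h1]
    change |φ x⁺ - φ x⁻| ≤ _
    rw [abs_le]
    constructor <;> linarith [h0 _ (posPart_nonneg x), h0 _ (negPart_nonneg x)]
  have hsmall : ∀ ε > 0, ∃ δ > 0, ∀ x : E, ‖x‖ < δ → φ |x| < ε := by
    by_contra! hcon
    obtain ⟨ε, hε, hcon⟩ := hcon
    choose x hx hxε using fun n : ℕ => hcon ((1 / 2) ^ n / (n + 1)) (by positivity)
    have hsum : Summable fun n : ℕ => n • |x n| := by
      refine Summable.of_norm_bounded (g := fun n : ℕ => (1 / 2 : ℝ) ^ n)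
        summable_geometric_two fun n => ?_
      refine (norm_nsmul_le).trans ?_
      rw [norm_abs_eq_norm]
      have h1 : (n + 1 : ℝ) * ‖x n‖ ≤ (1 / 2) ^ n := by
        rw [mul_comm]
        exact (le_div_iff₀ (by positivity)).1 (hx n).le
      linarith [norm_nonneg (x n)]
    obtain ⟨n, hn⟩ := exists_nat_gt (φ (∑' n : ℕ, n • |x n|) / ε)
    have hle : n • |x n| ≤ ∑' n : ℕ, n • |x n| :=
      hsum.le_tsum n fun m _ => nsmul_nonneg (abs_nonneg _) m
    have h2 := hmono _ _ (nsmul_nonneg (abs_nonneg (x n)) n) hle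
    rw [← hA _ (nsmul_nonneg (abs_nonneg (x n)) n), map_nsmul, hA _ (abs_nonneg _),
      nsmul_eq_mul] at h2
    rw [div_lt_iff₀ hε] at hn
    nlinarith [hxε n, (Nat.cast_nonneg n : (0 : ℝ) ≤ n)]
  have hcont : Continuous A := by
    refine continuous_of_continuousAt_zero A ?_
    rw [Metric.continuousAt_iff]
    intro ε hε
    obtain ⟨δ, hδ, h⟩ := hsmall ε hε
    refine ⟨δ, hδ, fun {x} hx => ?_⟩
    rw [map_zero, dist_zero_right]
    exact (habs x).trans_lt (h x (by simpa using hx))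
  refine ⟨A.toRealLinearMap hcont, fun x hx => ?_, fun x hx => hA x hx⟩
  exact (h0 x hx).trans_eq (hA x hx).symm

/-- A subadditive function with bounded sums over the partitions of each positive element is
dominated by a positive functional. -/
theorem exists_dual_ge_of_partition_bounded (p : E → ℝ) (hp0 : ∀ x, 0 ≤ p x)
    (hp : ∀ x y, p (x + y) ≤ p x + p y)
    (hb : ∀ x, 0 ≤ x → ∃ C, ∀ l : List E, (∀ z ∈ l, 0 ≤ z) → l.sum = x → (l.map p).sum ≤ C) :
    ∃ f : StrongDual ℝ E, 0 ≤ f ∧ ∀ x, 0 ≤ x → p x ≤ f x := by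
  let S : E → Set ℝ := fun x => {r | ∃ l : List E, (∀ z ∈ l, 0 ≤ z) ∧ l.sum = x ∧ (l.map p).sum = r}
  have hbdd : ∀ x, 0 ≤ x → BddAbove (S x) := fun x hx => by
    obtain ⟨C, hC⟩ := hb x hx
    refine ⟨C, ?_⟩
    rintro _ ⟨l, hl, hs, rfl⟩
    exact hC l hl hs
  have hmem : ∀ x, 0 ≤ x → p x ∈ S x := fun x hx => ⟨[x], by simpa using hx, by simp, by simp⟩
  have hle : ∀ x, 0 ≤ x → p x ≤ sSup (S x) := fun x hx => le_csSup (hbdd x hx) (hmem x hx)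
  obtain ⟨f, hf, hfS⟩ := exists_dual_of_additive (fun x => sSup (S x))
    (fun x hx => (hp0 x).trans (hle x hx)) (fun x y hx hy => by
      apply le_antisymm
      · refine csSup_le ⟨_, hmem _ (add_nonneg hx hy)⟩ ?_
        rintro _ ⟨l, hl, hs, rfl⟩
        obtain ⟨l₁, l₂, h₁, s₁, h₂, s₂, h⟩ := exists_partition_add hp l x y hx hy hl hs
        exact h.trans (add_le_add (le_csSup (hbdd x hx) ⟨l₁, h₁, s₁, rfl⟩)
          (le_csSup (hbdd y hy) ⟨l₂, h₂, s₂, rfl⟩))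
      · rw [← csSup_add ⟨_, hmem x hx⟩ (hbdd x hx) ⟨_, hmem y hy⟩ (hbdd y hy)]
        refine csSup_le (Set.Nonempty.add ⟨_, hmem x hx⟩ ⟨_, hmem y hy⟩) ?_
        rintro _ ⟨_, ⟨l₁, h₁, s₁, rfl⟩, _, ⟨l₂, h₂, s₂, rfl⟩, rfl⟩
        refine le_csSup (hbdd _ (add_nonneg hx hy)) ⟨l₁ ++ l₂, ?_, by simp [s₁, s₂], by simp⟩
        intro z hz
        exact (List.mem_append.1 hz).elim (h₁ z) (h₂ z))
  exact ⟨f, hf, fun x hx => (hle x hx).trans_eq (hfS x hx).symm⟩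

/-- The component of a positive functional `f` carried by a positive element `u`. -/
theorem exists_component {f : StrongDual ℝ E} (hf : 0 ≤ f) {u : E} (hu : 0 ≤ u) :
    ∃ g : StrongDual ℝ E, 0 ≤ g ∧
      ∀ x, 0 ≤ x → Tendsto (fun k : ℕ => f (x ⊓ k • u)) atTop (𝓝 (g x)) := by
  have hlim : ∀ x, 0 ≤ x →
      Tendsto (fun k : ℕ => f (x ⊓ k • u)) atTop (𝓝 (⨆ k : ℕ, f (x ⊓ k • u))) := by
    intro x hx
    refine tendsto_atTop_ciSup (fun k l hkl => dual_mono hf (inf_le_inf_left _ ?_)) ⟨f x, ?_⟩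
    · exact nsmul_le_nsmul_left hu hkl
    · rintro _ ⟨k, rfl⟩
      exact dual_mono hf inf_le_left
  have hnn : ∀ x, 0 ≤ x → ∀ k : ℕ, 0 ≤ x ⊓ k • u := fun x hx k => le_inf hx (nsmul_nonneg hu k)
  obtain ⟨g, hg, hgf⟩ := exists_dual_of_additive (fun x => ⨆ k : ℕ, f (x ⊓ k • u))
    (fun x hx => ge_of_tendsto' (hlim x hx) fun k => dual_nonneg hf (hnn x hx k))
    (fun x y hx hy => by
      have hxy := add_nonneg hx hy
      apply le_antisymm
      · refine le_of_tendsto_of_tendsto' (hlim _ hxy) ((hlim x hx).add (hlim y hy)) fun k => ?_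
        rw [← map_add]
        exact dual_mono hf (add_inf_le hx hy (nsmul_nonneg hu k))
      · refine le_of_tendsto' ((hlim x hx).add (hlim y hy)) fun k => ?_
        rw [← map_add]
        refine (dual_mono hf (inf_nsmul_add_le x y u k k)).trans ?_
        exact (monotone_nat_of_le_succ fun l => dual_mono hf (inf_le_inf_left _
          (nsmul_le_nsmul_left hu l.le_succ))).ge_of_tendsto (hlim _ hxy) (k + k))
  exact ⟨g, hg, fun x hx => by rw [hgf x hx]; exact hlim x hx⟩

/-- Every positive functional tends to zero along norm bounded disjoint positive sequences. -/
def DisjointWeaklyNull (E : Type*) [NormedAddCommGroup E] [NormedSpace ℝ E] [Lattice E]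
    [IsOrderedAddMonoid E] : Prop :=
  ∀ (f : StrongDual ℝ E) (x : ℕ → E), 0 ≤ f → DisjointSeq x → (∀ n, 0 ≤ x n) →
    (∃ C : ℝ, ∀ n, ‖x n‖ ≤ C) → Tendsto (fun n => f (x n)) atTop (𝓝 0)

theorem IsKBSpace.disjointWeaklyNull (h : IsKBSpace (StrongDual ℝ E)) : DisjointWeaklyNull E := by
  rintro f x hf hx hx0 ⟨C, hC⟩
  have hd : ∀ m n, m ≠ n → x m ⊓ x n = 0 := fun m n hmn => by
    simpa only [abs_of_nonneg (hx0 _)] using hx m n hmn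
  choose g hg hgf using fun n => exists_component hf (hx0 n)
  let G : ℕ → StrongDual ℝ E := fun n => ∑ i ∈ Finset.range n, g i
  have hG0 : ∀ n, 0 ≤ G n := fun n y hy => by
    simpa [G] using Finset.sum_nonneg fun i _ => dual_nonneg (hg i) hy
  have hGf : ∀ n, G n ≤ f := fun n y hy => by
    have h1 : Tendsto (fun k : ℕ => ∑ i ∈ Finset.range n, f (y ⊓ k • x i)) atTop
        (𝓝 (∑ i ∈ Finset.range n, g i y)) := tendsto_finsetSum _ fun i _ => hgf i y hy
    have h2 : G n y = ∑ i ∈ Finset.range n, g i y := by simp [G]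
    rw [h2]
    refine le_of_tendsto' h1 fun k => ?_
    rw [← map_sum]
    have hk : ∀ i, 0 ≤ y ⊓ k • x i := fun i => le_inf hy (nsmul_nonneg (hx0 i) k)
    refine dual_mono hf (sum_range_le_of_disjoint hy hk (fun _ => inf_le_left)
      (fun i j hij => ?_) n)
    exact inf_eq_zero_of_le (hk i) (hk j) inf_le_right inf_le_right
      (nsmul_inf_nsmul_eq_zero (hx0 j) (hx0 i) (hd i j hij) k)
  have hsucc : ∀ n, G (n + 1) = G n + g n := fun n => Finset.sum_range_succ _ _
  obtain ⟨a, ha⟩ := h G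
    (monotone_nat_of_le_succ fun n y hy => by
      rw [hsucc]
      simpa using dual_nonneg (hg n) hy)
    hG0 ⟨‖f‖, fun n => norm_le_norm_of_dual_le (hG0 n) (hGf n)⟩
  have hg0 : Tendsto (fun n => ‖g n‖) atTop (𝓝 0) := by
    have h1 := ((tendsto_add_atTop_iff_nat 1).2 ha).sub ha
    simpa [hsucc] using h1.norm
  have hb : Tendsto (fun n => ‖g n‖ * C) atTop (𝓝 0) := by simpa using hg0.mul_const C
  refine squeeze_zero (fun n => dual_nonneg hf (hx0 n)) (fun n => ?_) hb
  have h1 : f (x n) ≤ g n (x n) :=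
    ge_of_tendsto (hgf n (x n) (hx0 n)) <| (eventually_ge_atTop 1).mono fun k hk => by
      refine dual_mono hf (le_inf le_rfl ?_)
      simpa using nsmul_le_nsmul_left (hx0 n) hk
  refine h1.trans ((le_abs_self _).trans (((g n).le_opNorm (x n)).trans ?_))
  exact mul_le_mul_of_nonneg_left (hC n) (norm_nonneg _)

end Functionals
section Operators

variable {E F : Type*} [NormedAddCommGroup E] [NormedSpace ℝ E] [Lattice E] [IsOrderedAddMonoid E]
  [NormedAddCommGroup F] [NormedSpace ℝ F] [Lattice F] [IsOrderedAddMonoid F]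

theorem IsPositiveOp.isOrderBoundedOp {T : E →L[ℝ] F} (hT : IsPositiveOp T) :
    IsOrderBoundedOp T := by
  have hmono : Monotone T := fun x y h => by
    have := hT (y - x) (sub_nonneg.2 h)
    rwa [map_sub, sub_nonneg] at this
  rintro s ⟨a, b, hs⟩
  refine ⟨T a, T b, ?_⟩
  rintro _ ⟨x, hx, rfl⟩
  exact ⟨hmono (hs hx).1, hmono (hs hx).2⟩

theorem IsRegularOp.isOrderBoundedOp {T : E →L[ℝ] F} (hT : IsRegularOp T) :
    IsOrderBoundedOp T := by
  obtain ⟨R, S, hR, hS, rfl⟩ := hT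
  intro s hs
  obtain ⟨a, b, hab⟩ := hR.isOrderBoundedOp s hs
  obtain ⟨c, d, hcd⟩ := hS.isOrderBoundedOp s hs
  refine ⟨a - d, b - c, ?_⟩
  rintro _ ⟨x, hx, rfl⟩
  have h1 := hab ⟨x, hx, rfl⟩
  have h2 := hcd ⟨x, hx, rfl⟩
  exact ⟨sub_le_sub h1.1 h2.2, sub_le_sub h1.2 h2.1⟩

theorem IsRankOne.isCompactOperator {E F : Type*} [NormedAddCommGroup E] [NormedSpace ℝ E]
    [NormedAddCommGroup F] [NormedSpace ℝ F] {T : E →L[ℝ] F} (hT : IsRankOne T) : IsCompactOperator T := by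
  have : FiniteDimensional ℝ (LinearMap.range (T : E →ₗ[ℝ] F)) :=
    Module.finite_of_finrank_eq_succ hT
  have : LocallyCompactSpace (LinearMap.range (T : E →ₗ[ℝ] F)) :=
    have := FiniteDimensional.proper_real (LinearMap.range (T : E →ₗ[ℝ] F)); inferInstance
  let V := LinearMap.range (T : E →ₗ[ℝ] F)
  let S : E →L[ℝ] V := T.codRestrict V fun x => ⟨x, rfl⟩
  have hS : IsCompactOperator S := isCompactOperator_of_locallyCompactSpace_dom S
  exact hS.clm_comp V.subtypeL

/-- Rank one operators detect all functionals. -/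
theorem disjointWeaklyNull_of_smulRight {y : F} (hy : y ≠ 0)
    (h : ∀ f : StrongDual ℝ E, 0 ≤ f → f ≠ 0 → IsOrderMWeaklyCompact (f.smulRight y)) :
    DisjointWeaklyNull E := by
  intro f x hf hx _ hC
  by_cases hf0 : f = 0
  · simp [hf0]
  obtain ⟨g, -, hg⟩ := exists_dual_vector ℝ y (norm_ne_zero_iff.2 hy)
  have h1 := h f hf hf0 (fun _ => g) x ⟨g, g, by rintro _ ⟨n, rfl⟩; exact ⟨le_rfl, le_rfl⟩⟩ hx hC
  have h2 := h1.mul_const ‖y‖⁻¹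
  have hy' : ‖y‖ ≠ 0 := norm_ne_zero_iff.2 hy
  simpa [hg, hy'] using h2

theorem isRankOne_smulRight {E F : Type*} [NormedAddCommGroup E] [NormedSpace ℝ E]
    [NormedAddCommGroup F] [NormedSpace ℝ F] {f : StrongDual ℝ E} (hf : f ≠ 0) {y : F} (hy : y ≠ 0) :
    IsRankOne (f.smulRight y) := by
  obtain ⟨x, hx⟩ : ∃ x, f x ≠ 0 := by
    by_contra! hcon
    exact hf (ContinuousLinearMap.ext hcon)
  have : LinearMap.range (f.smulRight y : E →ₗ[ℝ] F) = Submodule.span ℝ {y} := by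
    ext w
    rw [Submodule.mem_span_singleton]
    constructor
    · rintro ⟨v, rfl⟩
      exact ⟨f v, rfl⟩
    · rintro ⟨c, rfl⟩
      exact ⟨(c / f x) • x, by simp [smul_smul, hx]⟩
  rw [IsRankOne, this, finrank_span_singleton hy]

end Operators

section Null

variable {E : Type*} [NormedAddCommGroup E] [NormedSpace ℝ E] [CompleteSpace E] [Lattice E]
  [IsOrderedAddMonoid E] [HasSolidNorm E]

/-- A function dominated on the positive cone as in `exists_dual_ge_of_partition_bounded` tends
to zero along norm bounded disjoint sequences. -/
theorem DisjointWeaklyNull.tendsto_of_partition_bounded (hD : DisjointWeaklyNull E)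
    (p : E → ℝ) (hp0 : ∀ x, 0 ≤ p x) (hp : ∀ x y, p (x + y) ≤ p x + p y) (hneg : ∀ x, p (-x) = p x)
    (hb : ∀ x, 0 ≤ x → ∃ C, ∀ l : List E, (∀ z ∈ l, 0 ≤ z) → l.sum = x → (l.map p).sum ≤ C)
    {x : ℕ → E} (hx : DisjointSeq x) (hC : ∃ C : ℝ, ∀ n, ‖x n‖ ≤ C) :
    Tendsto (fun n => p (x n)) atTop (𝓝 0) := by
  obtain ⟨f, hf, hpf⟩ := exists_dual_ge_of_partition_bounded p hp0 hp hb
  have h := hD f (fun n => |x n|) hf (disjointSeq_abs hx) (fun n => abs_nonneg _)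
    (by simpa only [norm_abs_eq_norm] using hC)
  refine squeeze_zero (fun n => hp0 _) (fun n => ?_) h
  have h1 := hp (x n)⁺ (-(x n)⁻)
  rw [← sub_eq_add_neg, posPart_sub_negPart, hneg] at h1
  rw [← posPart_add_negPart, map_add]
  exact h1.trans (add_le_add (hpf _ (posPart_nonneg _)) (hpf _ (negPart_nonneg _)))

theorem DisjointWeaklyNull.tendsto_dual (hD : DisjointWeaklyNull E) (f : StrongDual ℝ E)
    {x : ℕ → E} (hx : DisjointSeq x) (hC : ∃ C : ℝ, ∀ n, ‖x n‖ ≤ C) :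
    Tendsto (fun n => f (x n)) atTop (𝓝 0) := by
  rw [tendsto_zero_iff_abs_tendsto_zero]
  refine hD.tendsto_of_partition_bounded (fun x => |f x|) (fun _ => abs_nonneg _)
    (fun x y => by rw [map_add]; exact abs_add_le _ _) (fun x => by rw [map_neg, abs_neg])
    (fun x hx => ⟨‖f‖ * ‖x‖, fun l hl hs => ?_⟩) hx hC
  refine list_sum_abs_bounds (f : E →+ ℝ) (fun y hy => ?_) l hl hs
  refine (le_abs_self _).trans ((f.le_opNorm y).trans
    (mul_le_mul_of_nonneg_left (norm_le_norm_of_abs_le_abs ?_) (norm_nonneg f)))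
  rwa [abs_of_nonneg hx]

variable {F : Type*} [NormedAddCommGroup F] [NormedSpace ℝ F] [Lattice F]
  [IsOrderedAddMonoid F]

/-- If positive functionals are null along `|T (x n)|`, then order bounded sequences of functionals
are null along `T (x n)`. -/
theorem DisjointWeaklyNull.isOrderMWeaklyCompact (hD : DisjointWeaklyNull E) {T : E →L[ℝ] F}
    (hT : ∀ (h : StrongDual ℝ F) (x : ℕ → E), 0 ≤ h → DisjointSeq x →
      (∃ C : ℝ, ∀ n, ‖x n‖ ≤ C) → Tendsto (fun n => h |T (x n)|) atTop (𝓝 0)) :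
    IsOrderMWeaklyCompact T := by
  rintro f x ⟨a, b, hab⟩ hx hC
  have hf : ∀ n, a ≤ f n ∧ f n ≤ b := fun n => hab ⟨n, rfl⟩
  have h1 : Tendsto (fun n => a (T (x n))) atTop (𝓝 0) := hD.tendsto_dual (a.comp T) hx hC
  have h2 := hT (b - a) x (dual_sub_nonneg ((hf 0).1.trans (hf 0).2)) hx hC
  have h3 : Tendsto (fun n => (f n - a) (T (x n))) atTop (𝓝 0) := by
    rw [tendsto_zero_iff_abs_tendsto_zero]
    refine squeeze_zero (fun n => abs_nonneg _) (fun n => ?_) h2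
    exact abs_apply_le (dual_sub_nonneg (hf n).1)
      (fun y hy => by simpa using (hf n).2 y hy) _
  simpa using h1.add h3

theorem DisjointWeaklyNull.isOrderMWeaklyCompact_of_isOrderBoundedOp (hD : DisjointWeaklyNull E)
    {T : E →L[ℝ] F} (hT : IsOrderBoundedOp T) : IsOrderMWeaklyCompact T := by
  refine hD.isOrderMWeaklyCompact fun h x hh hx hC => ?_
  refine hD.tendsto_of_partition_bounded (fun x => h |T x|)
    (fun x => dual_nonneg hh (abs_nonneg _)) (fun x y => ?_) (fun x => by rw [map_neg, abs_neg])
    (fun x hx => ?_) hx hC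
  · rw [← map_add, map_add T]
    exact dual_mono hh (abs_add_le _ _)
  · obtain ⟨a, b, hab⟩ := hT (Set.Icc (-x) x) ⟨_, _, le_rfl⟩
    refine ⟨h b, fun l hl hs => ?_⟩
    have h1 := list_sum_abs_bounds (T : E →+ F) (w := b)
      (fun y hy => (hab ⟨y, abs_le'.1 hy |>.symm.imp_left neg_le.1, rfl⟩).2) l hl hs
    have h2 := dual_mono hh h1
    rw [map_list_sum, List.map_map] at h2
    exact h2

theorem DisjointWeaklyNull.isOrderMWeaklyCompact_of_isCompactOperator [HasSolidNorm F]
    (hD : DisjointWeaklyNull E) {T : E →L[ℝ] F} (hT : IsCompactOperator T) :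
    IsOrderMWeaklyCompact T := by
  refine hD.isOrderMWeaklyCompact fun h x _ hx ⟨C, hC⟩ => ?_
  have hTx : Tendsto (fun n => T (x n)) atTop (𝓝 0) := by
    obtain ⟨K, hK, hTK⟩ := hT.image_closedBall_subset_compact (f := (T : E →ₗ[ℝ] F)) C
    have hmem : ∀ n, T (x n) ∈ K := fun n => hTK ⟨x n, by simpa using hC n, rfl⟩
    refine tendsto_of_subseq_tendsto fun ns hns => ?_
    obtain ⟨y, -, ψ, hψ, hy⟩ := hK.tendsto_subseq fun n => hmem (ns n)
    refine ⟨ψ, ?_⟩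
    have hy0 : y = 0 := by
      obtain ⟨g, -, hg⟩ := exists_dual_vector'' ℝ y
      have h1 := (hD.tendsto_dual (g.comp T) hx ⟨C, hC⟩).comp (hns.comp hψ.tendsto_atTop)
      have h2 := tendsto_nhds_unique ((g.continuous.tendsto y).comp hy) h1
      rw [hg] at h2
      simpa using h2
    rwa [hy0] at hy
  have h1 : Tendsto (fun n => |T (x n)|) atTop (𝓝 0) := by
    rw [tendsto_zero_iff_norm_tendsto_zero] at hTx ⊢
    simpa only [norm_abs_eq_norm] using hTx
  simpa [Function.comp_def] using (h.continuous.tendsto 0).comp h1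

end Null

section

variable {E : Type*} [NormedAddCommGroup E] [NormedSpace ℝ E] [Lattice E] [IsOrderedAddMonoid E]
  [IsOrderedModule ℝ E]

theorem posPart_sub_smul_inf_eq_zero {u v : E} (hu : 0 ≤ u) {a b : ℝ} (ha : 1 ≤ a)
    (hab : 1 ≤ a * b) : (u - a • v)⁺ ⊓ (v - b • u)⁺ = 0 := by
  have ha0 : 0 < a := one_pos.trans_le ha
  refine inf_eq_zero_of_le (posPart_nonneg _) (posPart_nonneg _) le_rfl ?_
    (posPart_inf_negPart_eq_zero (u - a • v))
  rw [← posPart_neg, neg_sub]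
  refine sup_le ?_ (posPart_nonneg _)
  calc v - b • u ≤ v - a⁻¹ • u :=
        sub_le_sub_left (smul_le_smul_of_nonneg_right ((inv_le_iff_one_le_mul₀' ha0).2 hab) hu) v
    _ = a⁻¹ • (a • v - u) := by rw [smul_sub, inv_smul_smul₀ ha0.ne']
    _ ≤ a⁻¹ • (a • v - u)⁺ := smul_le_smul_of_nonneg_left (le_posPart _) (by positivity)
    _ ≤ (1 : ℝ) • (a • v - u)⁺ :=
        smul_le_smul_of_nonneg_right (inv_le_one_of_one_le₀ ha) (posPart_nonneg _)
    _ = _ := one_smul _ _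

end

variable {E : Type*} [NormedAddCommGroup E] [NormedSpace ℝ E] [CompleteSpace E] [Lattice E]
  [IsOrderedAddMonoid E] [IsOrderedModule ℝ E] [HasSolidNorm E]

theorem DisjointWeaklyNull.tendsto_norm_zero (hD : DisjointWeaklyNull E)
    {g : ℕ → StrongDual ℝ E} (hanti : Antitone g) (hg0 : ∀ n, 0 ≤ g n)
    (hnull : ∀ x, 0 ≤ x → Tendsto (fun n => g n x) atTop (𝓝 0)) :
    Tendsto (fun n => ‖g n‖) atTop (𝓝 0) := by
  by_contra hcon
  rw [Metric.tendsto_atTop] at hcon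
  push Not at hcon
  obtain ⟨ε, hε, hcon⟩ := hcon
  have hnorm : ∀ n, ε / 2 < ‖g n‖ := fun n => by
    obtain ⟨m, hm, h⟩ := hcon n
    rw [dist_zero_right, norm_norm] at h
    linarith [norm_le_norm_of_dual_le (hg0 m) (hanti hm)]
  have hx : ∀ n, ∃ x : E, 0 ≤ x ∧ ‖x‖ ≤ 1 ∧ ε / 2 ≤ g n x := fun n => by
    obtain ⟨x, hx1, hx2⟩ := (g n).exists_lt_apply_of_lt_opNorm (hnorm n)
    refine ⟨|x|, abs_nonneg x, (norm_abs_eq_norm x).trans_le hx1.le, hx2.le.trans ?_⟩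
    exact abs_apply_le (hg0 n) le_rfl x
  choose x hx0 hx1 hxε using hx
  have hS0 : ∀ m, 0 ≤ ∑ i ∈ Finset.range (m + 1), x i :=
    fun m => Finset.sum_nonneg fun i _ => hx0 i
  have hN : ∀ m, ∃ n, m < n ∧ g n (∑ i ∈ Finset.range (m + 1), x i) < (1 / 8) ^ m := fun m =>
    ((eventually_gt_atTop m).and
      ((hnull _ (hS0 m)).eventually_lt_const (by positivity))).exists
  choose N hmN hN using hN
  let φ : ℕ → ℕ := fun k => N^[k] 0
  have hφs : ∀ k, φ (k + 1) = N (φ k) := fun k => Function.iterate_succ_apply' N k 0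
  have hφ : StrictMono φ := strictMono_nat_of_lt_succ fun k => by rw [hφs]; exact hmN _
  let z : ℕ → E := fun k => x (φ k)
  have hz0 : ∀ k, 0 ≤ z k := fun k => hx0 _
  let S : ℕ → E := fun k => ∑ i ∈ Finset.range (φ k + 1), x i
  have hzS : ∀ j k, j ≤ k → z j ≤ S k := fun j k hjk =>
    Finset.single_le_sum (fun i _ => hx0 i)
      (Finset.mem_range.2 (Nat.lt_succ_of_le (hφ.monotone hjk)))
  have hsum : Summable fun k : ℕ => (1 / 2 : ℝ) ^ k • z k := by
    refine Summable.of_norm_bounded summable_geometric_two fun k => ?_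
    rw [norm_smul, Real.norm_of_nonneg (by positivity)]
    exact mul_le_of_le_one_right (by positivity) (hx1 _)
  have hw0 : ∀ k, 0 ≤ (1 / 2 : ℝ) ^ k • z k := fun k => smul_nonneg (by positivity) (hz0 k)
  let X : E := ∑' k, (1 / 2 : ℝ) ^ k • z k
  have hX0 : 0 ≤ X := tsum_nonneg hw0
  have hzX : ∀ k, (1 / 2 : ℝ) ^ k • z k ≤ X := fun k => hsum.le_tsum k fun m _ => hw0 m
  let y : ℕ → E := fun k => (z (k + 1) - (4 : ℝ) ^ k • S k - (1 / 2 : ℝ) ^ k • X)⁺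
  have hy0 : ∀ k, 0 ≤ y k := fun k => posPart_nonneg _
  have hyz : ∀ k, y k ≤ z (k + 1) := fun k => by
    refine sup_le ?_ (hz0 _)
    rw [sub_sub]
    exact sub_le_self _ (add_nonneg (smul_nonneg (by positivity) (hS0 _))
      (smul_nonneg (by positivity) hX0))
  have hlt : ∀ k m, k < m → y m ⊓ y k = 0 := by
    intro k m hkm
    refine inf_eq_zero_of_le (hy0 m) (hy0 k) (posPart_mono ?_) (posPart_mono ?_)
      (posPart_sub_smul_inf_eq_zero (u := z (m + 1)) (v := z (k + 1)) (hz0 _) (a := 4 ^ m)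
        (b := (1 / 2) ^ k * (1 / 2) ^ (m + 1)) (one_le_pow₀ (by norm_num)) ?_)
    · refine (sub_le_self _ (smul_nonneg (by positivity) hX0)).trans (sub_le_sub_left ?_ _)
      exact smul_le_smul_of_nonneg_left (hzS _ _ hkm) (by positivity)
    · refine sub_le_sub (sub_le_self _ (smul_nonneg (by positivity) (hS0 _))) ?_
      rw [mul_smul]
      exact smul_le_smul_of_nonneg_left (hzX _) (by positivity)
    · obtain ⟨d, rfl⟩ := Nat.exists_eq_add_of_lt hkm
      have h4 : (4 : ℝ) = 2 * 2 := by norm_num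
      rw [← pow_add, h4, mul_pow, ← pow_add, one_div, inv_pow, ← div_eq_mul_inv,
        one_le_div (by positivity)]
      exact pow_le_pow_right₀ (by norm_num) (by lia)
  have hydisj : DisjointSeq y := fun m n hmn => by
    rw [abs_of_nonneg (hy0 m), abs_of_nonneg (hy0 n)]
    rcases lt_or_gt_of_ne hmn with h | h
    · rw [inf_comm]; exact hlt m n h
    · exact hlt n m h
  have hlim := hD (g 0) y (hg0 0) hydisj hy0 ⟨1, fun k =>
    (norm_le_norm_of_abs_le_abs (by
      rw [abs_of_nonneg (hy0 k), abs_of_nonneg (hz0 _)]; exact hyz k)).trans (hx1 (φ (k + 1)))⟩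
  have hlow : ∀ k, ε / 2 - ((1 / 2) ^ k + (1 / 2) ^ k * g 0 X) ≤ g 0 (y k) := by
    intro k
    have h1 : g (φ (k + 1)) (y k) ≤ g 0 (y k) := hanti (Nat.zero_le _) _ (hy0 k)
    have h2 : g (φ (k + 1)) (z (k + 1) - (4 : ℝ) ^ k • S k - (1 / 2 : ℝ) ^ k • X)
        ≤ g (φ (k + 1)) (y k) := dual_mono (hg0 _) (le_posPart _)
    simp only [map_sub, map_smul, smul_eq_mul] at h2
    have h3 : ε / 2 ≤ g (φ (k + 1)) (z (k + 1)) := hxε _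
    have h4 : g (φ (k + 1)) (S k) ≤ (1 / 8) ^ k := by
      rw [hφs]
      exact (hN (φ k)).le.trans
        (pow_le_pow_of_le_one (by norm_num) (by norm_num) (hφ.le_apply))
    have h5 : (4 : ℝ) ^ k * g (φ (k + 1)) (S k) ≤ (1 / 2) ^ k := by
      refine (mul_le_mul_of_nonneg_left h4 (by positivity)).trans_eq ?_
      rw [← mul_pow]
      norm_num
    have h6 : (1 / 2 : ℝ) ^ k * g (φ (k + 1)) X ≤ (1 / 2) ^ k * g 0 X :=
      mul_le_mul_of_nonneg_left (hanti (Nat.zero_le _) X hX0) (by positivity)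
    linarith
  have hhalf : Tendsto (fun k : ℕ => (1 / 2 : ℝ) ^ k) atTop (𝓝 0) :=
    tendsto_pow_atTop_nhds_zero_of_lt_one (by norm_num) (by norm_num)
  have hlim2 := (hhalf.add (hhalf.mul_const (g 0 X))).const_sub (ε / 2)
  have := le_of_tendsto_of_tendsto' hlim2 hlim hlow
  simp only [zero_mul, add_zero, sub_zero] at this
  linarith

theorem DisjointWeaklyNull.isKBSpace (hD : DisjointWeaklyNull E) :
    IsKBSpace (StrongDual ℝ E) := by
  rintro f hmono hf0 ⟨C, hC⟩
  have hlim : ∀ x, 0 ≤ x → Tendsto (fun n => f n x) atTop (𝓝 (⨆ n, f n x)) := by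
    intro x hx
    refine tendsto_atTop_ciSup (fun m n hmn => hmono hmn x hx) ⟨C * ‖x‖, ?_⟩
    rintro _ ⟨n, rfl⟩
    exact (le_abs_self _).trans (((f n).le_opNorm x).trans
      (mul_le_mul_of_nonneg_right (hC n) (norm_nonneg x)))
  obtain ⟨F, -, hF⟩ := exists_dual_of_additive (fun x => ⨆ n, f n x)
    (fun x hx => ge_of_tendsto' (hlim x hx) fun n => dual_nonneg (hf0 n) hx)
    (fun x y hx hy => tendsto_nhds_unique (hlim _ (add_nonneg hx hy)) <| by
      simpa using (hlim x hx).add (hlim y hy))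
  have hlimF : ∀ x, 0 ≤ x → Tendsto (fun n => f n x) atTop (𝓝 (F x)) := fun x hx => by
    rw [hF x hx]; exact hlim x hx
  have hfF : ∀ n, f n ≤ F := fun n x hx =>
    Monotone.ge_of_tendsto (fun m k hmk => hmono hmk x hx) (hlimF x hx) n
  refine ⟨F, ?_⟩
  rw [tendsto_iff_norm_sub_tendsto_zero]
  have := hD.tendsto_norm_zero (g := fun n => F - f n)
    (fun m n hmn x hx => sub_le_sub_left (hmono hmn x hx) (F x)) (fun n => dual_sub_nonneg (hfF n))
    (fun x hx => by simpa using (hlimF x hx).const_sub (F x))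
  simpa only [norm_sub_rev] using this

instance hasSolidNorm_pi {ι : Type*} [Fintype ι] : HasSolidNorm (ι → ℝ) :=
  ⟨fun f g h => (pi_norm_le_iff_of_nonneg (norm_nonneg g)).2 fun i =>
    (HasSolidNorm.solid (h i : |f i| ≤ |g i|)).trans (norm_le_pi_norm g i)⟩

end BanachLattice

theorem mainTheorem3 (E : Type u)
    [NormedAddCommGroup E] [NormedSpace ℝ E] [CompleteSpace E] [Lattice E]
    [IsOrderedAddMonoid E] [IsOrderedModule ℝ E] [HasSolidNorm E] :
    List.TFAE [
      BanachLattice.IsKBSpace (StrongDual ℝ E),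
      ∀ (F : Type v) [NormedAddCommGroup F] [NormedSpace ℝ F] [CompleteSpace F] [Lattice F]
        [IsOrderedAddMonoid F] [IsOrderedModule ℝ F] [HasSolidNorm F] (T : E →L[ℝ] F),
        BanachLattice.IsOrderBoundedOp T → BanachLattice.IsOrderMWeaklyCompact T,
      ∀ (F : Type v) [NormedAddCommGroup F] [NormedSpace ℝ F] [CompleteSpace F] [Lattice F]
        [IsOrderedAddMonoid F] [IsOrderedModule ℝ F] [HasSolidNorm F] (T : E →L[ℝ] F),
        BanachLattice.IsRegularOp T → BanachLattice.IsOrderMWeaklyCompact T,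
      ∀ (F : Type v) [NormedAddCommGroup F] [NormedSpace ℝ F] [CompleteSpace F] [Lattice F]
        [IsOrderedAddMonoid F] [IsOrderedModule ℝ F] [HasSolidNorm F] (T : E →L[ℝ] F),
        IsCompactOperator T → BanachLattice.IsOrderMWeaklyCompact T,
      ∀ T : E →L[ℝ] E,
        BanachLattice.IsRankOne T → BanachLattice.IsOrderMWeaklyCompact T] := by
  have hy : (fun _ => 1 : PUnit.{v + 1} → ℝ) ≠ 0 := fun h => one_ne_zero (congrFun h PUnit.unit)
  tfae_have 1 → 2 := fun h F _ _ _ _ _ _ _ T hT =>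
    h.disjointWeaklyNull.isOrderMWeaklyCompact_of_isOrderBoundedOp hT
  tfae_have 2 → 3 := fun h F _ _ _ _ _ _ _ T hT => h F T hT.isOrderBoundedOp
  tfae_have 3 → 4 := fun h F _ _ _ _ _ _ _ T hT => by
    refine (BanachLattice.disjointWeaklyNull_of_smulRight hy fun f hf _ => h _ _
      ⟨_, 0, fun x hx _ => ?_, fun _ _ => le_rfl, (sub_zero _).symm⟩
      ).isOrderMWeaklyCompact_of_isCompactOperator hT
    simpa using BanachLattice.dual_nonneg hf hx
  tfae_have 4 → 5 := fun h T hT =>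
    (BanachLattice.disjointWeaklyNull_of_smulRight hy fun f _ hf => h _ _
      (BanachLattice.isRankOne_smulRight hf hy).isCompactOperator
      ).isOrderMWeaklyCompact_of_isCompactOperator hT.isCompactOperator
  tfae_have 5 → 1 := fun h => by
    rcases subsingleton_or_nontrivial E with hE | hE
    · exact fun f _ _ _ => ⟨0, by simp [Subsingleton.elim _ (0 : StrongDual ℝ E)]⟩
    · obtain ⟨y, hy⟩ := exists_ne (0 : E)
      exact (BanachLattice.disjointWeaklyNull_of_smulRight hy fun f _ hf => h _
        (BanachLattice.isRankOne_smulRight hf hy)).isKBSpace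
  tfae_finish
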